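/- All graphs are simple, and all vertex sets are non-empty. For a graph $G$, a vertex $v$ and an integer $R>0$, let $B_G(v,R)$ be the ball of radius $R$ around $v$ in the graph metric, with its induced graph structure and rooted at $v$. The Cheeger constant of a finite graph $G=(V,E)$ is $$h(G)=\min_{A\subset V}\Big\{\frac{|E(A,V\setminus A)|}{|A|} : 0<|A|\le |V|/2\Big\},$$ where $E(A,B)$ is the set of edges with one endpoint in $A$ and the other in $B$ (and $h(G)=\infty$ if $|V|=1$). In Bernoulli bond percolation with parameter $p$ on a graph, each edge is open with probability $p$ and closed otherwise, independently of all other edges; its law is $\mathbf P_p$. The critical probability of an infinite graph $G$ is $p_c(G)=\inf\{p\in[0,1] : \mathbf P_p(\text{there is an infinite open component})>0\}$. A sequence of finite graphs $G_n$ converges weakly to an infinite rooted graph $(G,\rho)$ if, for every integer $R>0$ and for $U_n$ a uniformly random vertex of $G_n$, $$\mathbf P\big(B_{G_n}(U_n,R)\text{ and }B_G(\rho,R)\text{ are not isomorphic as rooted graphs}\big)\to 0\quad\text{as } n\to\infty .$$ **Theorem 1.2.** Let $(G,\rho)$ be an infinite connected rooted graph of bounded degree, and let $(G_n)$ be a sequence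 of finite graphs such that, for some real $h>0$ and some integer $d$, every $G_n$ has Cheeger constant $h(G_n)\ge h$ and all vertex degrees at most $d$. Suppose that $G_n\to(G,\rho)$ weakly. Let $p\in[0,1]$, and let $G_n(p)$ be the random graph of open edges, on the vertex set of $G_n$, obtained from $G_n$ by bond percolation with parameter $p$. Write $|G_n|$ for the number of vertices of $G_n$. If $p<p_c(G)$, then for every $\alpha>0$ $$\mathbf P\big(G_n(p)\text{ contains a component of size at least }\alpha|G_n|\big)\to 0\quad\text{as } n\to\infty .$$ If $p>p_c(G)$, then there exists $\alpha>0$ such that $$\mathbf P\big(G_n(p)\text{ contains a component of size at least }\alpha|G_n|\big)\to 1\quad\text{as } n\to\infty .$$ -/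

import Mathlib

open Filter Topology MeasureTheory ProbabilityTheory unitInterval
open scoped ENNReal

/-- The set of vertices at graph distance at most `R` from `v`. -/
def graphBall {V : Type*} (G : SimpleGraph V) (v : V) (R : ℕ) : Set V :=
  {w | G.edist v w ≤ R}

theorem mem_graphBall_self {V : Type*} (G : SimpleGraph V) (v : V) (R : ℕ) :
    v ∈ graphBall G v R := by
  simp [graphBall]

/-- The balls `B_G(v, R)` and `B_H(w, R)`, with their induced graph structures and rooted at `v`
and `w`, are isomorphic as rooted graphs. -/
def BallsIso {V W : Type*} (G : SimpleGraph V) (v : V) (H : SimpleGraph W) (w : W) (R : ℕ) :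
    Prop :=
  ∃ φ : G.induce (graphBall G v R) ≃g H.induce (graphBall H w R),
    φ ⟨v, mem_graphBall_self G v R⟩ = ⟨w, mem_graphBall_self H w R⟩

/-- The probability that the balls of radius `R` around a uniformly random vertex of the finite
graph `G` and around `ρ` in `H` are not isomorphic as rooted graphs: the proportion of vertices
of `G` with this property. -/
noncomputable def probBallsNotIso {V W : Type*} (G : SimpleGraph V) (H : SimpleGraph W) (ρ : W)
    (R : ℕ) : ℝ :=
  ({v : V | ¬ BallsIso G v H ρ R}.ncard : ℝ) / (Nat.card V : ℝ)

/-- Weak (Benjamini–Schramm) convergence of a sequence of finite graphs to a fixed rooted graph. -/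
def WeaklyConverges {V : ℕ → Type*} (G : ∀ n, SimpleGraph (V n)) {W : Type*} (H : SimpleGraph W)
    (ρ : W) : Prop :=
  ∀ R : ℕ, 0 < R → Tendsto (fun n => probBallsNotIso (G n) H ρ R) atTop (𝓝 0)

/-- The set `E(A, B)` of edges with one endpoint in `A` and the other in `B`. -/
def edgesBetween {V : Type*} (G : SimpleGraph V) (A B : Set V) : Set (Sym2 V) :=
  {e ∈ G.edgeSet | ∃ a ∈ A, ∃ b ∈ B, e = s(a, b)}

/-- The Cheeger constant of a finite graph: the minimum of `|E(A, V \ A)| / |A|` over the vertex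
sets `A` with `0 < |A| ≤ |V| / 2`. It takes values in `[0, ∞]`, and it is `∞` exactly when there is
no such `A`, that is, when `G` has at most one vertex. -/
noncomputable def cheegerConst {V : Type*} (G : SimpleGraph V) : ℝ≥0∞ :=
  ⨅ (A : Set V) (_ : 0 < A.ncard ∧ 2 * A.ncard ≤ Nat.card V),
    ((edgesBetween G A Aᶜ).ncard : ℝ≥0∞) / (A.ncard : ℝ≥0∞)

/-- Every vertex of `G` has degree at most `d`. -/
def DegreeBoundedBy {V : Type*} (G : SimpleGraph V) (d : ℕ) : Prop :=
  ∀ v, (G.neighborSet v).encard ≤ d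

/-- The law of the random set of open edges in Bernoulli bond percolation on `G`: each edge is
open with probability `p`, independently of all the others. -/
noncomputable def percolation {V : Type*} (G : SimpleGraph V) (p : I) : Measure (Set (Sym2 V)) :=
  setBernoulli G.edgeSet p

/-- The subgraph of `G`, on all the vertices of `G`, whose edges are those of `G` that lie in the
set `S` of open edges. -/
def openGraph {V : Type*} (G : SimpleGraph V) (S : Set (Sym2 V)) : SimpleGraph V :=
  SimpleGraph.fromEdgeSet (S ∩ G.edgeSet)

/-- The event that there is an infinite open component. -/
def infiniteComponentEvent {V : Type*} (G : SimpleGraph V) : Set (Set (Sym2 V)) :=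
  {S | ∃ c : (openGraph G S).ConnectedComponent, c.supp.Infinite}

/-- The critical probability for Bernoulli bond percolation,
`p_c(G) = inf {p ∈ [0, 1] : P_p(there is an infinite component) > 0}`. -/
noncomputable def criticalProb {V : Type*} (G : SimpleGraph V) : I :=
  sInf {p : I | 0 < percolation G p (infiniteComponentEvent G)}

/-- For a finite graph `G`, the event that there is an open component of size at least
`α |G|`. -/
def linearComponentEvent {V : Type*} (G : SimpleGraph V) (α : ℝ) : Set (Set (Sym2 V)) :=
  {S | ∃ c : (openGraph G S).ConnectedComponent, α * (Nat.card V : ℝ) ≤ (c.supp.ncard : ℝ)}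

/-! Whether a vertex starts an open path of length k is decided inside its ball of radius k, so weak
convergence transfers the probability of this event from `ρ` to most vertices of `Gn n`. Let X be
the set of vertices of `Gn n` that start such a path, and N the number of all vertices.

Below criticality this probability at `ρ` tends to 0 as k grows, so E|X| is a small multiple of N. A
component with at least αN vertices is eventually larger than every ball of radius k, hence lies in
X, and Markov's inequality rules it out. Expansion plays no role.

Above criticality, a slightly smaller parameter already gives |X| ≥ θN/2 with high probability, by
Chebyshev, with θ independent of k. Now sprinkle independent extra edges of density ε. If every
component stays below αN, α = θ/6, then X splits into two parts of size at least αN, each a union of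
traces of old components, with no sprinkled connection between them
(`exists_cut_of_small_components`). Old components meeting X have more than k vertices, so there are
at most 2^(N/(k+1)) splits. Expansion supplies linearly many edge-disjoint paths of bounded length
between the two parts, so a given split survives with probability exponentially small in N, at a
rate independent of k (`percolation_noConnectionEvent_le`). A large k therefore beats the number of
splits (`exists_sprinkling_parameters`). -/

/-! ### Bernoulli random sets: void probabilities, independence, sprinkling -/

section SetBernoulli

variable {ι κ : Type*}

theorem measurable_set_mem_iff {Ω : Type*} [MeasurableSpace Ω] {f : Ω → Set ι} :
    Measurable f ↔ ∀ i, MeasurableSet {ω | i ∈ f ω} := by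
  simp_rw [measurable_set_iff, measurableSet_setOfPred]

theorem measurableSet_disjoint_finset (F : Finset ι) :
    MeasurableSet {S : Set ι | Disjoint (F : Set ι) S} := by
  have : {S : Set ι | Disjoint (F : Set ι) S} = ⋂ i ∈ F, {S : Set ι | i ∈ S}ᶜ := by
    ext S; simp [Set.disjoint_left]
  rw [this]
  exact Finset.measurableSet_biInter _ fun i _ ↦ (measurableSet_mem i).compl

theorem setBernoulli_disjoint (u : Set ι) (p : I) (F : Finset ι) [DecidablePred (· ∈ u)] :
    setBernoulli u p {S | Disjoint (F : Set ι) S} =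
      ∏ i ∈ F, if i ∈ u then (toNNReal (σ p) : ℝ≥0∞) else 1 := by
  classical
  rw [setBernoulli_apply']
  have : (fun q : ι → Prop ↦ {i | q i}) ⁻¹' {S | Disjoint (F : Set ι) S} =
      Set.pi F (fun _ ↦ {False}) := by
    ext q; simp [Set.disjoint_left, Set.mem_pi]
  rw [this, Measure.infinitePi_pi _ (fun _ _ ↦ measurableSet_singleton _)]
  refine Finset.prod_congr rfl fun i _ ↦ ?_
  have h1 : (toNNReal p : ℝ≥0∞) + toNNReal (σ p) = 1 := by
    rw [← ENNReal.coe_add, ← ENNReal.coe_one]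
    congr 1
    ext
    simp
  by_cases hi : i ∈ u <;> simp [hi, h1]

theorem setBernoulli_superset (u : Set ι) (p : I) (F : Finset ι) (hF : (F : Set ι) ⊆ u) :
    setBernoulli u p {S | (F : Set ι) ⊆ S} = (toNNReal p : ℝ≥0∞) ^ F.card := by
  classical
  rw [setBernoulli_apply']
  have : (fun q : ι → Prop ↦ {i | q i}) ⁻¹' {S | (F : Set ι) ⊆ S} =
      Set.pi F (fun _ ↦ {True}) := by
    ext q; simp [Set.subset_def, Set.mem_pi]
  rw [this, Measure.infinitePi_pi _ (fun _ _ ↦ measurableSet_singleton _), Finset.prod_eq_pow_card]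
  intro i hi
  have := hF hi
  simp [this]

/-- Void events form a π-system, as intersecting them amounts to uniting the finite sets, and
complements of the singleton ones generate the σ-algebra. They suit unions of independent sets,
whose void probabilities multiply. -/
theorem MeasureTheory.Measure.ext_of_disjoint_finset {μ ν : Measure (Set ι)} [IsProbabilityMeasure μ]
    [IsProbabilityMeasure ν]
    (h : ∀ F : Finset ι, μ {S | Disjoint (F : Set ι) S} = ν {S | Disjoint (F : Set ι) S}) :
    μ = ν := by
  classical
  refine ext_of_generate_finite (Set.range fun F : Finset ι ↦ {S : Set ι | Disjoint (F : Set ι) S})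
    ?_ ?_ ?_ (by simp)
  · refine le_antisymm ?_ ?_
    · intro s hs
      have : @Measurable _ _ (MeasurableSpace.generateFrom
          (Set.range fun F : Finset ι ↦ {S : Set ι | Disjoint (F : Set ι) S})) _
          (id : Set ι → Set ι) := by
        refine (@measurable_set_mem_iff ι (Set ι) (_) id).2 fun i ↦ ?_
        have h2 : {S : Set ι | i ∈ id S} = {S | Disjoint (({i} : Finset ι) : Set ι) S}ᶜ := by
          ext S; simp
        rw [h2]
        exact MeasurableSet.compl (MeasurableSpace.measurableSet_generateFrom ⟨{i}, rfl⟩)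
      exact this hs
    · exact MeasurableSpace.generateFrom_le (by rintro _ ⟨F, rfl⟩; exact measurableSet_disjoint_finset F)
  · rintro _ ⟨F, rfl⟩ _ ⟨F', rfl⟩ _
    refine ⟨F ∪ F', ?_⟩
    ext S; simp [Set.disjoint_union_left]
  · rintro _ ⟨F, rfl⟩; exact h F

theorem measurable_set_union : Measurable fun z : Set ι × Set ι ↦ z.1 ∪ z.2 := by
  rw [measurable_set_mem_iff]
  intro i
  exact ((measurableSet_mem i).preimage measurable_fst).union
    ((measurableSet_mem i).preimage measurable_snd)

theorem map_union_prod_setBernoulli {u v w : Set ι} {p q r : I}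
    [DecidablePred (· ∈ u)] [DecidablePred (· ∈ v)] [DecidablePred (· ∈ w)]
    (h : ∀ i, (if i ∈ u then (toNNReal (σ p) : ℝ≥0∞) else 1) *
      (if i ∈ v then (toNNReal (σ q) : ℝ≥0∞) else 1) =
      if i ∈ w then (toNNReal (σ r) : ℝ≥0∞) else 1) :
    ((setBernoulli u p).prod (setBernoulli v q)).map (fun z ↦ z.1 ∪ z.2) = setBernoulli w r := by
  have := Measure.isProbabilityMeasure_map (μ := (setBernoulli u p).prod (setBernoulli v q))
    (measurable_set_union (ι := ι)).aemeasurable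
  refine MeasureTheory.Measure.ext_of_disjoint_finset fun F ↦ ?_
  rw [Measure.map_apply measurable_set_union (measurableSet_disjoint_finset F)]
  have : (fun z : Set ι × Set ι ↦ z.1 ∪ z.2) ⁻¹' {S | Disjoint (F : Set ι) S} =
      {S | Disjoint (F : Set ι) S} ×ˢ {S | Disjoint (F : Set ι) S} := by
    ext z; simp [Set.disjoint_union_right]
  rw [this, Measure.prod_prod]
  simp_rw [setBernoulli_disjoint, ← Finset.prod_mul_distrib, h]

theorem measurable_set_preimage (f : κ → ι) : Measurable fun S : Set ι ↦ f ⁻¹' S := by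
  rw [measurable_set_mem_iff]
  intro i
  exact measurableSet_mem (f i)

theorem map_preimage_setBernoulli {f : κ → ι} (hf : Function.Injective f) (u : Set ι) (p : I) :
    (setBernoulli u p).map (fun S ↦ f ⁻¹' S) = setBernoulli (f ⁻¹' u) p := by
  classical
  have := Measure.isProbabilityMeasure_map (μ := setBernoulli u p)
    (measurable_set_preimage f).aemeasurable
  refine MeasureTheory.Measure.ext_of_disjoint_finset fun F ↦ ?_
  rw [Measure.map_apply (measurable_set_preimage f) (measurableSet_disjoint_finset F)]
  have : (fun S : Set ι ↦ f ⁻¹' S) ⁻¹' {S | Disjoint (F : Set κ) S} =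
      {S | Disjoint ((F.map ⟨f, hf⟩ : Finset ι) : Set ι) S} := by
    ext S; simp [Set.disjoint_left]
  rw [this, setBernoulli_disjoint, setBernoulli_disjoint, Finset.prod_map]
  simp

/-- An event that is determined by the intersection of the random set with `a`. -/
def DependsOnlyOn (A : Set (Set ι)) (a : Set ι) : Prop :=
  ∀ S T : Set ι, S ∩ a = T ∩ a → (S ∈ A ↔ T ∈ A)

/-- The random set is the union of independent Bernoulli subsets of `u ∩ a` and `u \ a`. Almost
surely `A` reads only the first and `B` only the second, so `A ∩ B` becomes a rectangle of the
product measure. -/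
theorem setBernoulli_inter_of_dependsOnlyOn [Countable ι] {u : Set ι} {p : I} {A B : Set (Set ι)}
    {a b : Set ι} (hA : MeasurableSet A) (hB : MeasurableSet B) (hAa : DependsOnlyOn A a)
    (hBb : DependsOnlyOn B b) (hab : Disjoint a b) :
    setBernoulli u p (A ∩ B) = setBernoulli u p A * setBernoulli u p B := by
  classical
  have hmap : ((setBernoulli (u ∩ a) p).prod (setBernoulli (u \ a) p)).map (fun z ↦ z.1 ∪ z.2) =
      setBernoulli u p := by
    refine map_union_prod_setBernoulli fun i ↦ ?_
    by_cases h1 : i ∈ u <;> by_cases h2 : i ∈ a <;> simp [h1, h2]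
  have hsub : ∀ᵐ z ∂(setBernoulli (u ∩ a) p).prod (setBernoulli (u \ a) p),
      z.1 ⊆ u ∩ a ∧ z.2 ⊆ u \ a :=
    (Measure.quasiMeasurePreserving_fst.ae setBernoulli_ae_subset).and
      (Measure.quasiMeasurePreserving_snd.ae setBernoulli_ae_subset)
  have h1 : ∀ S T : Set ι, S ⊆ u ∩ a → T ⊆ u \ a → ((S ∪ T ∈ A ↔ S ∈ A) ∧ (S ∪ T ∈ B ↔ T ∈ B)) := by
    intro S T hS hT
    refine ⟨hAa _ _ ?_, hBb _ _ ?_⟩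
    · ext i; have := @hT i; simp at this ⊢; tauto
    · ext i; have := @hS i; have h' : i ∈ a → i ∉ b := fun h ↦ Set.disjoint_left.1 hab h; simp at this ⊢; tauto
  have key : ∀ (C : Set (Set ι × Set ι)) (D : Set (Set ι)), MeasurableSet D →
      (∀ S T : Set ι, S ⊆ u ∩ a → T ⊆ u \ a → (S ∪ T ∈ D ↔ (S, T) ∈ C)) →
      setBernoulli u p D = (setBernoulli (u ∩ a) p).prod (setBernoulli (u \ a) p) C := by
    intro C D hD h
    rw [← hmap, Measure.map_apply measurable_set_union hD]
    refine measure_congr ?_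
    filter_upwards [hsub] with z hz
    exact propext (h z.1 z.2 hz.1 hz.2)
  rw [key (A ×ˢ B) (A ∩ B) (hA.inter hB) (fun S T hS hT ↦ by simp [h1 S T hS hT]),
    key (A ×ˢ Set.univ) A hA (fun S T hS hT ↦ by simp [h1 S T hS hT]),
    key (Set.univ ×ˢ B) B hB (fun S T hS hT ↦ by simp [h1 S T hS hT]), Measure.prod_prod,
    Measure.prod_prod, Measure.prod_prod]
  simp

theorem exists_sprinkling {p q : I} (hpq : p < q) :
    ∃ ε : I, 0 < ε ∧ ∀ {ι : Type*} (u : Set ι),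
      ((setBernoulli u p).prod (setBernoulli u ε)).map (fun z ↦ z.1 ∪ z.2) = setBernoulli u q := by
  have h1 : (0 : ℝ) < 1 - p := by have := q.2.2; have : (p : ℝ) < q := hpq; linarith
  -- The value solves (1 - p)(1 - ε) = 1 - q.
  refine ⟨⟨(q - p) / (1 - p), by
    have : (p : ℝ) < q := hpq
    constructor
    · exact div_nonneg (by linarith) h1.le
    · rw [div_le_one h1]; linarith [q.2.2]⟩, ?_, ?_⟩
  · have : (p : ℝ) < q := hpq
    rw [← Subtype.coe_lt_coe]
    exact div_pos (by linarith) h1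
  · intro ι u
    classical
    refine map_union_prod_setBernoulli fun i ↦ ?_
    by_cases hi : i ∈ u <;> simp only [hi, if_true, if_false, mul_one]
    rw [← ENNReal.coe_mul]
    congr 1
    ext
    simp
    field_simp
    ring

end SetBernoulli

/-! ### Open paths as local events -/

section Paths

variable {V W : Type*}

/-- There is a path of length `k` starting at `v`. -/
def HasPathFrom (H : SimpleGraph V) (v : V) (k : ℕ) : Prop :=
  ∃ w, ∃ q : H.Walk v w, q.IsPath ∧ q.length = k

/-- The event that there is an open path of length `k` starting at `v`. -/
def pathEvent (G : SimpleGraph V) (v : V) (k : ℕ) : Set (Set (Sym2 V)) :=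
  {S | HasPathFrom (openGraph G S) v k}

theorem openGraph_adj {G : SimpleGraph V} {S : Set (Sym2 V)} {a b : V} :
    (openGraph G S).Adj a b ↔ s(a, b) ∈ S ∧ G.Adj a b := by
  simp only [openGraph, SimpleGraph.fromEdgeSet_adj, Set.mem_inter_iff, SimpleGraph.mem_edgeSet]
  exact ⟨fun h ↦ h.1, fun h ↦ ⟨h, h.2.ne⟩⟩

theorem openGraph_le (G : SimpleGraph V) (S : Set (Sym2 V)) : openGraph G S ≤ G :=
  fun _ _ h ↦ (openGraph_adj.1 h).2

theorem openGraph_mono (G : SimpleGraph V) {S T : Set (Sym2 V)} (h : S ⊆ T) :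
    openGraph G S ≤ openGraph G T :=
  fun _ _ hab ↦ openGraph_adj.2 ⟨h (openGraph_adj.1 hab).1, (openGraph_adj.1 hab).2⟩

theorem openGraph_preimage {G : SimpleGraph V} {H : SimpleGraph W} (f : G ↪g H)
    (S : Set (Sym2 W)) : openGraph G (Sym2.map f ⁻¹' S) = (openGraph H S).comap f := by
  ext a b
  simp [openGraph_adj]

theorem map_preimage_percolation {G : SimpleGraph V} {H : SimpleGraph W} (f : G ↪g H) (p : I) :
    (percolation H p).map (fun S ↦ Sym2.map f ⁻¹' S) = percolation G p := by
  rw [percolation, percolation, map_preimage_setBernoulli (Sym2.map.injective f.injective)]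
  congr 1
  ext e
  induction e with
  | _ a b => simp

theorem HasPathFrom.map {H : SimpleGraph V} {H' : SimpleGraph W} {f : H →g H'}
    (hf : Function.Injective f) {v : V} {k : ℕ} (h : HasPathFrom H v k) :
    HasPathFrom H' (f v) k := by
  obtain ⟨w, q, hq, hk⟩ := h
  exact ⟨f w, q.map f, hq.map hf, by simpa using hk⟩

theorem HasPathFrom.of_le {H : SimpleGraph V} {v : V} {k l : ℕ} (h : HasPathFrom H v k)
    (hl : l ≤ k) : HasPathFrom H v l := by
  obtain ⟨w, q, hq, hk⟩ := h
  exact ⟨_, q.take l, hq.take l, by simp [hk, hl]⟩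

theorem mem_graphBall_iff {G : SimpleGraph V} {v w : V} {R : ℕ} :
    w ∈ graphBall G v R ↔ ∃ q : G.Walk v w, q.length ≤ R := by
  constructor
  · intro h
    obtain ⟨q, hq⟩ := SimpleGraph.exists_walk_of_edist_ne_top (ne_top_of_le_ne_top (by simp) h)
    refine ⟨q, ?_⟩
    have h' : G.edist v w ≤ R := h
    rw [← hq] at h'
    exact_mod_cast h'
  · rintro ⟨q, hq⟩
    exact (SimpleGraph.edist_le q).trans (by exact_mod_cast hq)

/-- A path of length `k` cannot leave the ball of radius `k`. Hence path events live on a finite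
graph when balls are finite, which gives measurability, invariance under `BallsIso` and locality. -/
theorem hasPathFrom_induce_graphBall {G H : SimpleGraph V} (hHG : H ≤ G) (v : V) (k : ℕ) :
    HasPathFrom (H.induce (graphBall G v k)) ⟨v, mem_graphBall_self G v k⟩ k ↔
      HasPathFrom H v k := by
  classical
  constructor
  · intro h
    exact h.map (f := (SimpleGraph.Embedding.induce (graphBall G v k)).toHom)
      Subtype.val_injective
  · rintro ⟨w, q, hq, hk⟩
    have hs : ∀ x ∈ q.support, x ∈ graphBall G v k := fun x hx ↦ mem_graphBall_iff.2
      ⟨(q.takeUntil x hx).mapLe hHG, by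
        simpa [← hk] using q.length_takeUntil_le_length hx⟩
    refine ⟨_, q.induce _ hs, ?_, ?_⟩
    · rw [← SimpleGraph.Walk.isPath_map_iff_of_injective
        (f := (SimpleGraph.Embedding.induce (graphBall G v k)).toHom) Subtype.val_injective]
      rwa [SimpleGraph.Walk.map_induce]
    · rw [← SimpleGraph.Walk.length_map
        (SimpleGraph.Embedding.induce (graphBall G v k)).toHom, SimpleGraph.Walk.map_induce]
      exact hk

theorem pathEvent_eq_preimage (G : SimpleGraph V) (v : V) (k : ℕ) :
    pathEvent G v k = (fun S ↦ Sym2.map (SimpleGraph.Embedding.induce (G := G)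
      (graphBall G v k)) ⁻¹' S) ⁻¹' pathEvent (G.induce (graphBall G v k))
        ⟨v, mem_graphBall_self G v k⟩ k := by
  ext S
  simp only [pathEvent, Set.mem_preimage, Set.mem_ofPred_eq]
  rw [openGraph_preimage, ← hasPathFrom_induce_graphBall (openGraph_le G S)]
  rfl

theorem measurableSet_of_finite {ι : Type*} [Finite ι] (A : Set (Set ι)) : MeasurableSet A :=
  (Set.toFinite A).measurableSet

theorem measurableSet_pathEvent {G : SimpleGraph V} {v : V} {k : ℕ}
    (h : (graphBall G v k).Finite) : MeasurableSet (pathEvent G v k) := by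
  have := h.to_subtype
  rw [pathEvent_eq_preimage]
  exact measurable_set_preimage _ (measurableSet_of_finite _)

theorem percolation_pathEvent_induce {G : SimpleGraph V} {v : V} {k : ℕ}
    (h : (graphBall G v k).Finite) (p : I) :
    percolation G p (pathEvent G v k) = percolation (G.induce (graphBall G v k)) p
      (pathEvent (G.induce (graphBall G v k)) ⟨v, mem_graphBall_self G v k⟩ k) := by
  have := h.to_subtype
  rw [pathEvent_eq_preimage, ← map_preimage_percolation (SimpleGraph.Embedding.induce
    (graphBall G v k)), Measure.map_apply (measurable_set_preimage _) (measurableSet_of_finite _)]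

theorem percolation_pathEvent_iso [Finite V] {G : SimpleGraph V} {H : SimpleGraph W}
    (φ : G ≃g H) (v : V) (k : ℕ) (p : I) :
    percolation H p (pathEvent H (φ v) k) = percolation G p (pathEvent G v k) := by
  rw [← map_preimage_percolation φ.toEmbedding,
    Measure.map_apply (measurable_set_preimage _) (measurableSet_of_finite _)]
  congr 1
  ext S
  simp only [pathEvent, Set.mem_preimage, Set.mem_ofPred_eq]
  rw [openGraph_preimage]
  let ψ : (openGraph H S).comap φ ≃g openGraph H S := SimpleGraph.Iso.comap φ.toEquiv _
  constructor
  · intro h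
    have := h.map (f := ψ.symm.toHom) ψ.symm.injective
    have h2 : ψ.symm.toHom (φ v) = v := ψ.symm_apply_apply v
    rwa [h2] at this
  · intro h
    exact h.map (f := ψ.toHom) ψ.injective

theorem BallsIso.percolation_pathEvent {G : SimpleGraph V} {H : SimpleGraph W} {v : V} {w : W}
    {k : ℕ} (h : BallsIso G v H w k) (hfin : (graphBall H w k).Finite) (p : I) :
    percolation G p (pathEvent G v k) = percolation H p (pathEvent H w k) := by
  obtain ⟨φ, hφ⟩ := h
  have := hfin.to_subtype
  have h1 : Finite (graphBall G v k) := Finite.of_equiv _ φ.toEquiv.symm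
  rw [percolation_pathEvent_induce (Set.toFinite _), percolation_pathEvent_induce hfin, ← hφ,
    percolation_pathEvent_iso]

theorem dependsOnlyOn_pathEvent (G : SimpleGraph V) (v : V) (k : ℕ) :
    DependsOnlyOn (pathEvent G v k) {e | ∀ x ∈ e, x ∈ graphBall G v k} := by
  intro S T hST
  rw [pathEvent_eq_preimage]
  have : Sym2.map (SimpleGraph.Embedding.induce (G := G) (graphBall G v k)) ⁻¹' S =
      Sym2.map (SimpleGraph.Embedding.induce (G := G) (graphBall G v k)) ⁻¹' T := by
    ext e
    have h1 : Sym2.map (SimpleGraph.Embedding.induce (G := G) (graphBall G v k)) e ∈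
        {e | ∀ x ∈ e, x ∈ graphBall G v k} := by
      induction e with
      | _ a b => simp
    have h2 := Set.ext_iff.1 hST (Sym2.map (SimpleGraph.Embedding.induce (G := G)
      (graphBall G v k)) e)
    simp only [Set.mem_inter_iff, h1, and_true] at h2
    exact h2
  simp only [Set.mem_preimage, this]

theorem encard_graphBall_le {G : SimpleGraph V} {d : ℕ} (hG : DegreeBoundedBy G d) (v : V) (k : ℕ) :
    (graphBall G v k).encard ≤ ((d + 1) ^ k : ℕ) := by
  induction k with
  | zero =>
    have : graphBall G v 0 = {v} := by
      ext w; simp [graphBall, eq_comm (a := w)]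
    simp [this]
  | succ k ih =>
    have hfin : (graphBall G v k).Finite := Set.finite_of_encard_le_coe ih
    have hsub : graphBall G v (k + 1) ⊆ ⋃ w ∈ hfin.toFinset, insert w (G.neighborSet w) := by
      intro x hx
      obtain ⟨q, hq⟩ := mem_graphBall_iff.1 hx
      simp only [Set.mem_iUnion, Set.Finite.mem_toFinset, Set.mem_insert_iff, exists_prop]
      cases h : q.reverse with
      | nil => exact ⟨v, mem_graphBall_self G v k, Or.inl rfl⟩
      | cons hadj r =>
        rename_i y
        refine ⟨y, mem_graphBall_iff.2 ⟨r.reverse, ?_⟩, Or.inr hadj.symm⟩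
        have := congrArg SimpleGraph.Walk.length h
        simp at this ⊢
        omega
    have hcard : ∀ w, (insert w (G.neighborSet w)).encard ≤ ((d + 1 : ℕ) : ℕ∞) := fun w ↦
      (Set.encard_insert_le _ _).trans (by push_cast; gcongr; exact hG w)
    calc (graphBall G v (k + 1)).encard
        ≤ (⋃ w ∈ hfin.toFinset, insert w (G.neighborSet w)).encard := Set.encard_le_encard hsub
      _ ≤ ∑ w ∈ hfin.toFinset, (insert w (G.neighborSet w)).encard := by
          exact Finset.set_encard_biUnion_le _ _
      _ ≤ ∑ w ∈ hfin.toFinset, ((d + 1 : ℕ) : ℕ∞) := Finset.sum_le_sum fun w _ ↦ hcard w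
      _ ≤ ((d + 1) ^ (k + 1) : ℕ) := by
          rw [hfin.encard_eq_coe_toFinset_card] at ih
          rw [Finset.sum_const, nsmul_eq_mul, pow_succ]
          have : hfin.toFinset.card ≤ (d + 1) ^ k := by exact_mod_cast ih
          exact_mod_cast Nat.mul_le_mul_right _ this

/-- A path of `H` that leaves the `k`-ball of `G` has more than `k` edges; truncate it. With finite
balls, an infinite component thus yields paths of every length. -/
theorem hasPathFrom_of_notMem_graphBall {G H : SimpleGraph V} (hHG : H ≤ G) {v w : V} {k : ℕ}
    (hr : H.Reachable v w) (hw : w ∉ graphBall G v k) : HasPathFrom H v k := by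
  classical
  obtain ⟨q, hq⟩ := hr.exists_isPath
  refine HasPathFrom.of_le ⟨w, q, hq, rfl⟩ ?_
  by_contra! hlt
  exact hw (mem_graphBall_iff.2 ⟨q.mapLe hHG, by simpa using hlt.le⟩)

theorem HasPathFrom.le_encard {H : SimpleGraph V} {v : V} {k : ℕ} (h : HasPathFrom H v k) :
    ((k + 1 : ℕ) : ℕ∞) ≤ {w | H.Reachable v w}.encard := by
  classical
  obtain ⟨w, q, hq, hk⟩ := h
  have h1 : (q.support.toFinset : Set V) ⊆ {w | H.Reachable v w} := by
    intro x hx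
    exact ⟨q.takeUntil x (by simpa using hx)⟩
  refine le_trans ?_ (Set.encard_le_encard h1)
  rw [Set.encard_coe_eq_coe_finsetCard, List.toFinset_card_of_nodup hq.support_nodup]
  simp [hk]

theorem hasPathFrom_of_infinite {G H : SimpleGraph V} {d : ℕ} (hG : DegreeBoundedBy G d)
    (hHG : H ≤ G) {v : V} (h : {w | H.Reachable v w}.Infinite) (k : ℕ) : HasPathFrom H v k := by
  obtain ⟨w, hw, hw'⟩ := h.exists_notMem_finite
    (Set.finite_of_encard_le_coe (encard_graphBall_le hG v k))
  exact hasPathFrom_of_notMem_graphBall hHG hw hw'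

theorem infinite_of_hasPathFrom {H : SimpleGraph V} {v : V} (h : ∀ k, HasPathFrom H v k) :
    {w | H.Reachable v w}.Infinite := by
  intro hfin
  have := (h hfin.toFinset.card).le_encard
  rw [hfin.encard_eq_coe_toFinset_card] at this
  have : hfin.toFinset.card + 1 ≤ hfin.toFinset.card := by exact_mod_cast this
  omega

theorem SimpleGraph.Connected.countable {G : SimpleGraph V} (hG : G.Connected) {d : ℕ}
    (hd : DegreeBoundedBy G d) : Countable V := by
  obtain ⟨v⟩ := hG.nonempty
  rw [← Set.countable_univ_iff]
  refine (Set.countable_iUnion fun k ↦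
    (Set.finite_of_encard_le_coe (encard_graphBall_le hd v k)).countable).mono ?_
  intro w _
  obtain ⟨q⟩ := hG v w
  exact Set.mem_iUnion.2 ⟨q.length, mem_graphBall_iff.2 ⟨q, le_rfl⟩⟩

end Paths

/-! ### Expansion and the cost of a cut -/

section Expander

variable {V : Type*}

theorem mul_ncard_le_of_le_cheegerConst {G : SimpleGraph V} {h : ℝ}
    (hG : ENNReal.ofReal h ≤ cheegerConst G) {A : Set V} (hA : 0 < A.ncard)
    (hA' : 2 * A.ncard ≤ Nat.card V) : h * A.ncard ≤ (edgesBetween G A Aᶜ).ncard := by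
  have h1 : ENNReal.ofReal h ≤
      ((edgesBetween G A Aᶜ).ncard : ℝ≥0∞) / (A.ncard : ℝ≥0∞) := hG.trans (iInf₂_le A ⟨hA, hA'⟩)
  have hA0 : (0 : ℝ) < A.ncard := by exact_mod_cast hA
  rw [← ENNReal.ofReal_natCast, ← ENNReal.ofReal_natCast, ← ENNReal.ofReal_div_of_pos hA0,
    ENNReal.ofReal_le_ofReal_iff (by positivity), le_div_iff₀ hA0] at h1
  exact h1

/-- A boundary edge of `X` is either in `F` or ends in `Y \ X`, where each vertex accounts for at
most `d` edges. -/
theorem mul_ncard_le_add_mul_ncard_diff [Finite V] {G : SimpleGraph V} {h : ℝ}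
    (hG : ENNReal.ofReal h ≤ cheegerConst G) {d : ℕ} (hd : DegreeBoundedBy G d)
    (F : Finset (Sym2 V)) {X Y : Set V} (hX : 0 < X.ncard) (hX' : 2 * X.ncard ≤ Nat.card V)
    (hXY : ∀ x ∈ X, ∀ y, (G.deleteEdges F).Adj x y → y ∈ Y) :
    h * X.ncard ≤ F.card + d * (Y \ X).ncard := by
  classical
  refine (mul_ncard_le_of_le_cheegerConst hG hX hX').trans ?_
  have hfin : (Y \ X).Finite := Set.toFinite _
  have hsub : edgesBetween G X Xᶜ ⊆
      (F : Set (Sym2 V)) ∪ ⋃ y ∈ hfin.toFinset, (fun z ↦ s(y, z)) '' G.neighborSet y := by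
    rintro e ⟨he, x, hx, y, hy, rfl⟩
    by_cases heF : s(x, y) ∈ F
    · exact Or.inl heF
    · right
      have hyY : y ∈ Y := hXY x hx y (SimpleGraph.deleteEdges_adj.2 ⟨he, heF⟩)
      simp only [Set.mem_iUnion]
      exact ⟨y, by simpa using ⟨hyY, hy⟩, x, SimpleGraph.Adj.symm he, Sym2.eq_swap⟩
  have h2 : (edgesBetween G X Xᶜ).encard ≤ ((F.card + hfin.toFinset.card * d : ℕ) : ℕ∞) := by
    refine (Set.encard_le_encard hsub).trans ((Set.encard_union_le _ _).trans ?_)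
    push_cast
    rw [Set.encard_coe_eq_coe_finsetCard]
    gcongr
    refine (Finset.set_encard_biUnion_le _ _).trans ?_
    rw [← nsmul_eq_mul, ← Finset.sum_const]
    exact Finset.sum_le_sum fun y _ ↦ (Set.encard_image_le _ _).trans (hd y)
  rw [← (Set.toFinite (edgesBetween G X Xᶜ)).cast_ncard_eq] at h2
  have h3 : (edgesBetween G X Xᶜ).ncard ≤ F.card + hfin.toFinset.card * d := by exact_mod_cast h2
  rw [← Set.ncard_eq_toFinset_card _ hfin] at h3
  have h4 : ((edgesBetween G X Xᶜ).ncard : ℝ) ≤ F.card + (Y \ X).ncard * d := by exact_mod_cast h3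
  linarith

/-- The set of vertices within distance `i` of the set `A`. -/
def neighborhood (G : SimpleGraph V) (A : Set V) (i : ℕ) : Set V :=
  {w | ∃ v ∈ A, ∃ q : G.Walk v w, q.length ≤ i}

/-- Deleting `F` costs at most half of the boundary guaranteed by expansion, so until half of the
graph is filled each step adds at least ha/(2d) vertices. Two such neighborhoods must then meet. -/
theorem lt_two_mul_ncard_neighborhood [Finite V] {G : SimpleGraph V} {h a : ℝ} (hh : 0 < h)
    (ha : 0 < a) (hG : ENNReal.ofReal h ≤ cheegerConst G) {d : ℕ} (hd : DegreeBoundedBy G d)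
    {F : Finset (Sym2 V)} (hF : 2 * F.card ≤ h * a) {A : Set V} (hA : a ≤ A.ncard) {l : ℕ}
    (hl : d * Nat.card V < l * (h * a)) :
    Nat.card V < 2 * (neighborhood (G.deleteEdges F) A l).ncard := by
  set X := neighborhood (G.deleteEdges F) A
  have hmono : ∀ i, X i ⊆ X (i + 1) := fun i w ⟨v, hv, q, hq⟩ ↦ ⟨v, hv, q, by omega⟩
  have hmono' : Monotone X := monotone_nat_of_le_succ hmono
  have hAX : ∀ i, a ≤ (X i).ncard := fun i ↦ hA.trans (by
    exact_mod_cast Set.ncard_le_ncard (t := X i) fun v hv ↦ ⟨v, hv, .nil, by simp⟩)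
  have key : ∀ i, 2 * (X i).ncard ≤ Nat.card V → i * (h * a) ≤ 2 * (d * (X i).ncard) := by
    intro i
    induction i with
    | zero => intro _; simp; positivity
    | succ i ih =>
      intro hi
      have h1 : (X i).ncard ≤ (X (i + 1)).ncard := Set.ncard_le_ncard (hmono i)
      have h2 := ih (by omega)
      have h3 : h * (X i).ncard ≤ F.card + d * (X (i + 1) \ X i).ncard := by
        refine mul_ncard_le_add_mul_ncard_diff hG hd F ?_ (by omega) ?_
        · have := ha.trans_le (hAX i); exact_mod_cast this
        · rintro x ⟨v, hv, q, hq⟩ y hxy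
          exact ⟨v, hv, q.concat hxy, by simpa using hq⟩
      have h4 : ((X (i + 1) \ X i).ncard : ℝ) = (X (i + 1)).ncard - (X i).ncard := by
        rw [Set.ncard_sdiff (hmono i), Nat.cast_sub h1]
      have h5 : h * a ≤ h * (X i).ncard := by gcongr; exact hAX i
      rw [h4] at h3
      push_cast
      linarith
  by_contra! hcon
  have h1 := key l hcon
  have h2 : (2 * (X l).ncard : ℝ) ≤ Nat.card V := by exact_mod_cast hcon
  have h3 : (d : ℝ) * (2 * (X l).ncard) ≤ d * Nat.card V := by gcongr
  linarith

theorem exists_walk_deleteEdges_length_le [Finite V] {G : SimpleGraph V} {h a : ℝ} (hh : 0 < h)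
    (ha : 0 < a) (hG : ENNReal.ofReal h ≤ cheegerConst G) {d : ℕ} (hd : DegreeBoundedBy G d)
    {F : Finset (Sym2 V)} (hF : 2 * F.card ≤ h * a) {A B : Set V} (hA : a ≤ A.ncard)
    (hB : a ≤ B.ncard) {l : ℕ} (hl : d * Nat.card V < l * (h * a)) :
    ∃ x ∈ A, ∃ y ∈ B, ∃ q : (G.deleteEdges F).Walk x y, q.length ≤ 2 * l := by
  have h1 := lt_two_mul_ncard_neighborhood hh ha hG hd hF hA hl
  have h2 := lt_two_mul_ncard_neighborhood hh ha hG hd hF hB hl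
  obtain ⟨w, ⟨x, hx, q, hq⟩, ⟨y, hy, r, hr⟩⟩ : (neighborhood (G.deleteEdges F) A l ∩
      neighborhood (G.deleteEdges F) B l).Nonempty := by
    by_contra! hcon
    have h3 := Set.ncard_union_eq (Set.disjoint_iff_inter_eq_empty.2 hcon)
    have h4 := Set.ncard_le_card (neighborhood (G.deleteEdges F) A l ∪
      neighborhood (G.deleteEdges F) B l)
    omega
  exact ⟨x, hx, y, hy, q.append r.reverse, by simp; omega⟩

/-- The event that no open path that avoids `F` joins `A` to `B`. -/
def noConnectionEvent (G : SimpleGraph V) (A B : Set V) (F : Finset (Sym2 V)) :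
    Set (Set (Sym2 V)) :=
  {T | ∀ x ∈ A, ∀ y ∈ B, ¬ (openGraph G (T \ F)).Reachable x y}

theorem dependsOnlyOn_noConnectionEvent (G : SimpleGraph V) (A B : Set V) (F : Finset (Sym2 V)) :
    DependsOnlyOn (noConnectionEvent G A B F) (F : Set (Sym2 V))ᶜ := by
  intro S T hST
  simp only [noConnectionEvent, Set.mem_ofPred_eq, Set.sdiff_eq_compl_inter] at hST ⊢
  rw [Set.inter_comm _ S, Set.inter_comm _ T, hST]

/-- Edge-disjoint short paths are extracted one at a time: `F` holds the edges already used, and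
`hF` reserves room for `m` further paths of at most 2l edges. Each path must fail to be open,
independently of what happens off its edges. -/
theorem percolation_noConnectionEvent_le [Finite V] {G : SimpleGraph V} {h a : ℝ} (hh : 0 < h)
    (ha : 0 < a) (hG : ENNReal.ofReal h ≤ cheegerConst G) {d : ℕ} (hd : DegreeBoundedBy G d)
    {A B : Set V} (hA : a ≤ A.ncard) (hB : a ≤ B.ncard) {l : ℕ}
    (hl : d * Nat.card V < l * (h * a)) (ε : I) (m : ℕ) (F : Finset (Sym2 V))
    (hF : 2 * (F.card + m * (2 * l)) ≤ h * a) :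
    percolation G ε (noConnectionEvent G A B F) ≤
      (1 - (toNNReal ε : ℝ≥0∞) ^ (2 * l)) ^ m := by
  classical
  induction m generalizing F with
  | zero => rw [pow_zero, percolation]; exact prob_le_one
  | succ m ih =>
    push_cast at hF
    have hml : (0 : ℝ) ≤ (m + 1) * (2 * l) := by positivity
    obtain ⟨x, hx, y, hy, q, hq⟩ := exists_walk_deleteEdges_length_le hh ha hG hd
      (F := F) (by linarith) hA hB hl
    have hFcard : q.edges.toFinset.card ≤ 2 * l :=
      (List.toFinset_card_le _).trans (by simpa using hq)
    have hqF : ∀ e ∈ q.edges, e ∈ G.edgeSet ∧ e ∉ F := fun e he ↦ by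
      have := q.edges_subset_edgeSet he
      rwa [SimpleGraph.edgeSet_deleteEdges] at this
    have hsub : noConnectionEvent G A B F ⊆
        {T | (q.edges.toFinset : Set (Sym2 V)) ⊆ T}ᶜ ∩
          noConnectionEvent G A B (F ∪ q.edges.toFinset) := by
      refine fun T hT ↦ ⟨fun hqT ↦ hT x hx y hy ?_, fun x hx y hy hxy ↦ hT x hx y hy
        (hxy.mono (openGraph_mono _ (Set.sdiff_subset_sdiff_right (by simp))))⟩
      refine ⟨q.transfer _ fun e he ↦ ?_⟩
      have h1 := hqF e he
      have h2 : e ∈ T := hqT (by simpa using he)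
      induction e with
      | _ u v => exact openGraph_adj.2 ⟨⟨h2, h1.2⟩, h1.1⟩
    have hind : percolation G ε ({T | (q.edges.toFinset : Set (Sym2 V)) ⊆ T}ᶜ ∩
          noConnectionEvent G A B (F ∪ q.edges.toFinset)) = _ :=
      setBernoulli_inter_of_dependsOnlyOn (a := (q.edges.toFinset : Set (Sym2 V)))
        (b := (F ∪ q.edges.toFinset : Finset (Sym2 V))ᶜ)
        (measurableSet_of_finite _) (measurableSet_of_finite _) (by
          intro S T hST
          simp only [Set.mem_compl_iff, Set.mem_ofPred_eq]
          rw [← Set.inter_eq_right, ← Set.inter_eq_right (s := T), hST])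
        (dependsOnlyOn_noConnectionEvent _ _ _ _) (by
          rw [Set.disjoint_compl_right_iff_subset]; simp)
    refine (measure_mono hsub).trans ?_
    rw [hind, pow_succ']
    gcongr
    · rw [prob_compl_eq_one_sub (measurableSet_of_finite _), setBernoulli_superset _ _ _
        fun e he ↦ (hqF e (by simpa using he)).1]
      refine tsub_le_tsub_left (pow_le_pow_right_of_le_one' ?_ hFcard) _
      exact_mod_cast ε.2.2
    · refine ih _ ?_
      have h1 : (F ∪ q.edges.toFinset).card ≤ F.card + 2 * l :=
        (Finset.card_union_le _ _).trans (by omega)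
      have h2 : ((F ∪ q.edges.toFinset).card : ℝ) ≤ F.card + 2 * l := by exact_mod_cast h1
      linarith

/-- Add the weights one by one and stop on first reaching `a`; the overshoot is at most one weight.
-/
theorem exists_subset_le_sum_le {ι : Type*} (s : Finset ι) {w : ι → ℝ} {a : ℝ}
    (ha : 0 ≤ a) (hw : ∀ i ∈ s, w i ≤ a) (hs : a ≤ ∑ i ∈ s, w i) :
    ∃ t ⊆ s, a ≤ ∑ i ∈ t, w i ∧ ∑ i ∈ t, w i ≤ 2 * a := by
  classical
  induction s using Finset.induction_on with
  | empty => exact ⟨∅, le_rfl, hs, by simpa using ha⟩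
  | insert i s hi ih =>
    by_cases h : a ≤ ∑ i ∈ s, w i
    · obtain ⟨t, ht, h'⟩ := ih (fun j hj ↦ hw j (Finset.mem_insert_of_mem hj)) h
      exact ⟨t, ht.trans (Finset.subset_insert _ _), h'⟩
    · refine ⟨_, le_rfl, hs, ?_⟩
      rw [Finset.sum_insert hi]
      linarith [hw i (Finset.mem_insert_self _ _)]

/-- Distribute the components of S ∪ T into two groups, each with at least `a` vertices of `X`. The
cut is recorded by components of `S` alone, so for fixed `S` the candidate cuts can be enumerated
before `T` is revealed. -/
theorem exists_cut_of_small_components [Finite V] {G : SimpleGraph V} {S T : Set (Sym2 V)} {a : ℝ}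
    (ha : 0 ≤ a) {X : Finset V} (hX : 3 * a ≤ X.card)
    (hST : ∀ c : (openGraph G (S ∪ T)).ConnectedComponent, (c.supp.ncard : ℝ) < a) :
    ∃ 𝒜 : Set (openGraph G S).ConnectedComponent,
      a ≤ {v ∈ (X : Set V) | (openGraph G S).connectedComponentMk v ∈ 𝒜}.ncard ∧
      a ≤ {v ∈ (X : Set V) | (openGraph G S).connectedComponentMk v ∉ 𝒜}.ncard ∧
      T ∈ noConnectionEvent G {v ∈ (X : Set V) | (openGraph G S).connectedComponentMk v ∈ 𝒜}
        {v ∈ (X : Set V) | (openGraph G S).connectedComponentMk v ∉ 𝒜} ∅ := by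
  classical
  have := Fintype.ofFinite V
  set H := openGraph G (S ∪ T)
  have hSH : openGraph G S ≤ H := openGraph_mono _ Set.subset_union_left
  have hTH : openGraph G T ≤ H := openGraph_mono _ Set.subset_union_right
  let f : V → H.ConnectedComponent := H.connectedComponentMk
  have hsum : ∀ t : Finset H.ConnectedComponent,
      ∑ c ∈ t, (({v ∈ X | f v = c} : Finset V).card : ℝ) = ({v ∈ X | f v ∈ t} : Finset V).card := by
    intro t
    rw [Finset.card_eq_sum_card_fiberwise (f := f) (t := t) (s := {v ∈ X | f v ∈ t})
      fun v hv ↦ by simpa using (Finset.mem_filter.1 hv).2]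
    push_cast
    refine Finset.sum_congr rfl fun c hc ↦ ?_
    congr 2
    ext v
    simp only [Finset.mem_filter]
    constructor
    · rintro ⟨h1, rfl⟩; exact ⟨⟨h1, hc⟩, rfl⟩
    · rintro ⟨⟨h1, _⟩, h2⟩; exact ⟨h1, h2⟩
  have hXuniv : X.card = ({v ∈ X | f v ∈ X.image f} : Finset V).card := by
    congr 1
    ext v
    simp only [Finset.mem_filter, iff_self_and]
    exact fun h ↦ Finset.mem_image_of_mem f h
  obtain ⟨t, -, ht1, ht2⟩ := exists_subset_le_sum_le (X.image f) (a := a)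
    (w := fun c ↦ (({v ∈ X | f v = c} : Finset V).card : ℝ)) ha (fun c _ ↦ by
      refine le_trans ?_ (hST c).le
      rw [← Set.ncard_coe_finset]
      have hsub : (({v ∈ X | f v = c} : Finset V) : Set V) ⊆ c.supp :=
        fun v hv ↦ (Finset.mem_filter.1 hv).2
      exact_mod_cast Set.ncard_le_ncard hsub) (by
      rw [hsum, ← hXuniv]; linarith)
  rw [hsum] at ht1 ht2
  let 𝒜 : Set (openGraph G S).ConnectedComponent :=
    (openGraph G S).connectedComponentMk '' {v | f v ∈ t}
  have h𝒜 : ∀ v, (openGraph G S).connectedComponentMk v ∈ 𝒜 ↔ f v ∈ t := by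
    intro v
    constructor
    · rintro ⟨u, hu, huv⟩
      have : f u = f v := SimpleGraph.ConnectedComponent.sound
        ((SimpleGraph.ConnectedComponent.exact huv).mono hSH)
      rwa [← this]
    · exact fun h ↦ ⟨v, h, rfl⟩
  have hA : {v ∈ (X : Set V) | (openGraph G S).connectedComponentMk v ∈ 𝒜} =
      (({v ∈ X | f v ∈ t} : Finset V) : Set V) := by ext v; simp [h𝒜]
  have hB : {v ∈ (X : Set V) | (openGraph G S).connectedComponentMk v ∉ 𝒜} =
      (({v ∈ X | ¬ f v ∈ t} : Finset V) : Set V) := by ext v; simp [h𝒜]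
  refine ⟨𝒜, ?_, ?_, ?_⟩
  · rwa [hA, Set.ncard_coe_finset]
  · rw [hB, Set.ncard_coe_finset]
    have h1 := Finset.card_filter_add_card_filter_not (s := X) (fun v ↦ f v ∈ t)
    have h2 : (X.card : ℝ) = ({v ∈ X | f v ∈ t} : Finset V).card +
      ({v ∈ X | ¬ f v ∈ t} : Finset V).card := by exact_mod_cast h1.symm
    linarith
  · intro x hx y hy hxy
    have h1 := (h𝒜 x).1 hx.2
    have h2 : f y ∉ t := fun h ↦ hy.2 ((h𝒜 y).2 h)
    have h3 : f x = f y := SimpleGraph.ConnectedComponent.sound (by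
      simpa using (hxy.mono (openGraph_mono G Set.sdiff_subset)).mono hTH)
    exact h2 (h3 ▸ h1)

theorem percolation_small_components_le [Finite V] {G : SimpleGraph V} {h a : ℝ}
    (hh : 0 < h) (ha : 0 < a) (hG : ENNReal.ofReal h ≤ cheegerConst G) {d : ℕ}
    (hd : DegreeBoundedBy G d) {l m k : ℕ} (hl : d * Nat.card V < l * (h * a))
    (hm : 2 * (m * (2 * l)) ≤ h * a) (ε : I) {S : Set (Sym2 V)}
    (hS : 3 * a ≤ {v | S ∈ pathEvent G v k}.ncard) :
    percolation G ε {T | ∀ c : (openGraph G (S ∪ T)).ConnectedComponent,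
        (c.supp.ncard : ℝ) < a} ≤
      2 ^ (Nat.card V / (k + 1)) * (1 - (toNNReal ε : ℝ≥0∞) ^ (2 * l)) ^ m := by
  classical
  have := Fintype.ofFinite V
  let X : Finset V := {v | S ∈ pathEvent G v k}
  have hX : 3 * a ≤ X.card := by
    rw [← Set.ncard_coe_finset]; simpa [X] using hS
  let f : V → (openGraph G S).ConnectedComponent := (openGraph G S).connectedComponentMk
  let 𝒞 : Finset (openGraph G S).ConnectedComponent := X.image f
  -- Components in `𝒞` are disjoint and each contains a path with k + 1 vertices.
  have h𝒞 : 𝒞.card ≤ Nat.card V / (k + 1) := by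
    rw [Nat.le_div_iff_mul_le (by omega), mul_comm, Nat.card_eq_fintype_card, ← Finset.card_univ]
    calc (k + 1) * 𝒞.card ≤ ∑ c ∈ 𝒞, ({v | f v = c} : Finset V).card := by
          rw [mul_comm, ← smul_eq_mul]
          refine Finset.card_nsmul_le_sum _ _ _ fun c hc ↦ ?_
          obtain ⟨v, hv, rfl⟩ := Finset.mem_image.1 hc
          have h1 : HasPathFrom (openGraph G S) v k := (Finset.mem_filter.1 hv).2
          have h2 := h1.le_encard
          have h3 : {w | (openGraph G S).Reachable v w} =
              (({w | f w = f v} : Finset V) : Set V) := by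
            ext w
            simpa [f] using SimpleGraph.reachable_comm
          rw [h3, Set.encard_coe_eq_coe_finsetCard] at h2
          exact_mod_cast h2
      _ ≤ ∑ c, ({v | f v = c} : Finset V).card :=
          Finset.sum_le_sum_of_subset (Finset.subset_univ _)
      _ = (Finset.univ : Finset V).card :=
          (Finset.card_eq_sum_card_fiberwise fun v _ ↦ Finset.mem_univ _).symm
  let A (t : Finset (openGraph G S).ConnectedComponent) : Set V := {v ∈ (X : Set V) | f v ∈ t}
  let B (t : Finset (openGraph G S).ConnectedComponent) : Set V := {v ∈ (X : Set V) | f v ∉ t}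
  let 𝒯 := {t ∈ 𝒞.powerset | a ≤ (A t).ncard ∧ a ≤ (B t).ncard}
  have hsub : {T | ∀ c : (openGraph G (S ∪ T)).ConnectedComponent, (c.supp.ncard : ℝ) < a} ⊆
      ⋃ t ∈ 𝒯, noConnectionEvent G (A t) (B t) ∅ := by
    intro T hT
    obtain ⟨𝒜, h1, h2, h3⟩ := exists_cut_of_small_components ha.le hX hT
    -- Components that miss `X` do not affect the cut, so subsets of `𝒞` suffice for the union
    -- bound.
    let t : Finset (openGraph G S).ConnectedComponent := {c ∈ 𝒞 | c ∈ 𝒜}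
    have hA : {v ∈ (X : Set V) | (openGraph G S).connectedComponentMk v ∈ 𝒜} = A t := by
      ext v
      simp only [A, t, f, Set.mem_ofPred_eq, Finset.mem_filter]
      exact and_congr_right fun hv ↦ (and_iff_right (Finset.mem_image_of_mem f hv)).symm
    have hB : {v ∈ (X : Set V) | (openGraph G S).connectedComponentMk v ∉ 𝒜} = B t := by
      ext v
      simp only [B, t, f, Set.mem_ofPred_eq, Finset.mem_filter]
      exact and_congr_right fun hv ↦ not_congr (and_iff_right (Finset.mem_image_of_mem f hv)).symm
    rw [hA] at h1 h3
    rw [hB] at h2 h3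
    exact Set.mem_biUnion (x := t) (by simp [𝒯, t, h1, h2]) h3
  calc _ ≤ percolation G ε (⋃ t ∈ 𝒯, noConnectionEvent G (A t) (B t) ∅) := measure_mono hsub
    _ ≤ ∑ t ∈ 𝒯, percolation G ε (noConnectionEvent G (A t) (B t) ∅) :=
        measure_biUnion_finset_le _ _
    _ ≤ ∑ t ∈ 𝒯, (1 - (toNNReal ε : ℝ≥0∞) ^ (2 * l)) ^ m :=
        Finset.sum_le_sum fun t ht ↦ percolation_noConnectionEvent_le hh ha hG hd
          (Finset.mem_filter.1 ht).2.1 (Finset.mem_filter.1 ht).2.2 hl ε m ∅ (by simpa using hm)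
    _ = 𝒯.card * (1 - (toNNReal ε : ℝ≥0∞) ^ (2 * l)) ^ m := by rw [Finset.sum_const, nsmul_eq_mul]
    _ ≤ _ := by
        gcongr
        have h1 : 𝒯.card ≤ 2 ^ (Nat.card V / (k + 1)) :=
          (Finset.card_filter_le _ _).trans (by
            rw [Finset.card_powerset]; exact Nat.pow_le_pow_right (by omega) h𝒞)
        exact_mod_cast h1

end Expander

/-! ### Moments of the number of vertices with a long open path -/

section Concentration

variable {V W : Type*}

instance (G : SimpleGraph V) (p : I) : IsProbabilityMeasure (percolation G p) :=
  inferInstanceAs (IsProbabilityMeasure (setBernoulli G.edgeSet p))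

theorem ncard_pathEvent_eq_sum [Fintype V] (G : SimpleGraph V) (k : ℕ) (S : Set (Sym2 V)) :
    ({v | S ∈ pathEvent G v k}.ncard : ℝ) =
      ∑ v, (pathEvent G v k).indicator (1 : Set (Sym2 V) → ℝ) S := by
  classical
  rw [Set.ncard_eq_toFinset_card', Set.toFinset_ofPred, Finset.card_filter]
  push_cast
  exact Finset.sum_congr rfl fun v _ ↦ by simp [Set.indicator_apply]

theorem memLp_indicator_pathEvent [Finite V] (G : SimpleGraph V) (v : V) (k : ℕ) (p : I) :
    MemLp ((pathEvent G v k).indicator (1 : Set (Sym2 V) → ℝ)) 2 (percolation G p) :=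
  memLp_indicator_const 2 (measurableSet_of_finite _) (1 : ℝ) (Or.inr (measure_ne_top _ _))

theorem integral_ncard_pathEvent [Fintype V] (G : SimpleGraph V) (k : ℕ) (p : I) :
    ∫ S, ({v | S ∈ pathEvent G v k}.ncard : ℝ) ∂percolation G p =
      ∑ v, (percolation G p).real (pathEvent G v k) := by
  simp_rw [ncard_pathEvent_eq_sum]
  rw [integral_finsetSum _ fun v _ ↦ (memLp_indicator_pathEvent G v k p).integrable (by norm_num)]
  exact Finset.sum_congr rfl fun v _ ↦ integral_indicator_one (measurableSet_of_finite _)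

/-- Beyond distance 2k the two `k`-balls are disjoint, so the events are independent. Summed over
pairs, this makes the variance linear in the number of vertices, as Chebyshev's inequality requires.
-/
theorem covariance_indicator_pathEvent_le [Finite V] (G : SimpleGraph V) (k : ℕ) (p : I)
    (v w : V) : cov[(pathEvent G v k).indicator (1 : Set (Sym2 V) → ℝ),
      (pathEvent G w k).indicator (1 : Set (Sym2 V) → ℝ); percolation G p] ≤
      (graphBall G v (2 * k)).indicator 1 w := by
  have h1 : ∀ u, ∫ S, (pathEvent G u k).indicator (1 : Set (Sym2 V) → ℝ) S ∂percolation G p =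
      (percolation G p).real (pathEvent G u k) :=
    fun u ↦ integral_indicator_one (measurableSet_of_finite _)
  rw [covariance_eq_sub (memLp_indicator_pathEvent G v k p) (memLp_indicator_pathEvent G w k p),
    ← Set.inter_indicator_one, h1, h1, integral_indicator_one (measurableSet_of_finite _)]
  by_cases hw : w ∈ graphBall G v (2 * k)
  · rw [Set.indicator_of_mem hw]
    have h2 : (percolation G p).real (pathEvent G v k ∩ pathEvent G w k) ≤ 1 := measureReal_le_one
    have h3 : 0 ≤ (percolation G p).real (pathEvent G v k) *
      (percolation G p).real (pathEvent G w k) := by positivity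
    simp only [Pi.one_apply]
    linarith
  · rw [Set.indicator_of_notMem hw, measureReal_def, measureReal_def, measureReal_def,
      ← ENNReal.toReal_mul, percolation, setBernoulli_inter_of_dependsOnlyOn
      (measurableSet_of_finite _) (measurableSet_of_finite _) (dependsOnlyOn_pathEvent G v k)
      (dependsOnlyOn_pathEvent G w k), sub_self]
    rw [Set.disjoint_left]
    intro e he he'
    obtain ⟨x, hx⟩ : ∃ x, x ∈ e := ⟨_, Sym2.out_fst_mem e⟩
    obtain ⟨q, hq⟩ := mem_graphBall_iff.1 (he x hx)
    obtain ⟨r, hr⟩ := mem_graphBall_iff.1 (he' x hx)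
    exact hw (mem_graphBall_iff.2 ⟨q.append r.reverse, by simp; omega⟩)

theorem percolation_ncard_pathEvent_lt_le [Finite V] {G : SimpleGraph V} {d : ℕ}
    (hd : DegreeBoundedBy G d) (k : ℕ) (p : I) {t E : ℝ} (ht : 0 < t)
    (hE : E + t ≤ ∫ S, ({v | S ∈ pathEvent G v k}.ncard : ℝ) ∂percolation G p) :
    percolation G p {S | ({v | S ∈ pathEvent G v k}.ncard : ℝ) < E} ≤
      ENNReal.ofReal (Nat.card V * (d + 1) ^ (2 * k) / t ^ 2) := by
  classical
  have := Fintype.ofFinite V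
  have hmem : MemLp (fun S ↦ ({v | S ∈ pathEvent G v k}.ncard : ℝ)) 2 (percolation G p) := by
    simp_rw [ncard_pathEvent_eq_sum]
    exact memLp_finsetSum _ fun v _ ↦ memLp_indicator_pathEvent G v k p
  have hvar : Var[fun S ↦ ({v | S ∈ pathEvent G v k}.ncard : ℝ); percolation G p] ≤
      Nat.card V * (d + 1) ^ (2 * k) := by
    simp_rw [ncard_pathEvent_eq_sum]
    rw [variance_fun_sum fun v ↦ memLp_indicator_pathEvent G v k p]
    calc _ ≤ ∑ v : V, ∑ w, (graphBall G v (2 * k)).indicator (1 : V → ℝ) w :=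
          Finset.sum_le_sum fun v _ ↦ Finset.sum_le_sum fun w _ ↦
            covariance_indicator_pathEvent_le G k p v w
      _ ≤ ∑ v : V, ((d + 1) ^ (2 * k) : ℝ) := by
          refine Finset.sum_le_sum fun v _ ↦ ?_
          have h1 := encard_graphBall_le hd v (2 * k)
          rw [← (Set.toFinite _).cast_ncard_eq] at h1
          have h2 : (graphBall G v (2 * k)).ncard ≤ (d + 1) ^ (2 * k) := by exact_mod_cast h1
          have h3 : ∑ w, (graphBall G v (2 * k)).indicator (1 : V → ℝ) w =
              (graphBall G v (2 * k)).ncard := by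
            rw [Set.ncard_eq_toFinset_card']
            simp [Set.indicator_apply]
          rw [h3]
          exact_mod_cast h2
      _ = _ := by simp
  refine (measure_mono ?_).trans ((meas_ge_le_variance_div_sq hmem ht).trans
    (ENNReal.ofReal_le_ofReal (by gcongr)))
  intro S hS
  simp only [Set.mem_ofPred_eq] at hS ⊢
  rw [abs_sub_comm]
  exact (by linarith : t ≤ _).trans (le_abs_self _)

/-- Vertices whose ball matches that of `ρ` contribute exactly the limiting probability; each other
vertex contributes an error of at most 1. -/
theorem abs_integral_ncard_pathEvent_sub_le [Finite V] [Nonempty V] (G : SimpleGraph V)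
    (H : SimpleGraph W) {ρ : W} {k : ℕ} (hfin : (graphBall H ρ k).Finite) (p : I) :
    |∫ S, ({v | S ∈ pathEvent G v k}.ncard : ℝ) ∂percolation G p -
      Nat.card V * (percolation H p).real (pathEvent H ρ k)| ≤
      Nat.card V * probBallsNotIso G H ρ k := by
  classical
  have := Fintype.ofFinite V
  have hn : (Nat.card V : ℝ) ≠ 0 := by exact_mod_cast Nat.card_pos.ne'
  rw [integral_ncard_pathEvent, probBallsNotIso, mul_div_cancel₀ _ hn]
  have h1 : (Nat.card V : ℝ) * (percolation H p).real (pathEvent H ρ k) =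
      ∑ _v : V, (percolation H p).real (pathEvent H ρ k) := by simp
  rw [h1, ← Finset.sum_sub_distrib]
  refine (Finset.abs_sum_le_sum_abs _ _).trans ?_
  rw [Set.ncard_eq_toFinset_card', Set.toFinset_ofPred, Finset.card_filter]
  push_cast
  refine Finset.sum_le_sum fun v _ ↦ ?_
  by_cases h : BallsIso G v H ρ k
  · rw [measureReal_def, measureReal_def, h.percolation_pathEvent hfin p]
    simp [h]
  · have h2 : (percolation G p).real (pathEvent G v k) ≤ 1 := measureReal_le_one
    have h3 : (percolation H p).real (pathEvent H ρ k) ≤ 1 := measureReal_le_one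
    have h4 : 0 ≤ (percolation G p).real (pathEvent G v k) := measureReal_nonneg
    have h5 : 0 ≤ (percolation H p).real (pathEvent H ρ k) := measureReal_nonneg
    rw [if_pos h, abs_le]
    constructor <;> linarith

theorem mul_percolation_linearComponentEvent_le [Finite V] {G : SimpleGraph V} {d : ℕ}
    (hd : DegreeBoundedBy G d) (k : ℕ) (p : I) {α : ℝ}
    (hn : (d + 1) ^ k < α * Nat.card V) :
    α * Nat.card V * (percolation G p).real (linearComponentEvent G α) ≤
      ∫ S, ({v | S ∈ pathEvent G v k}.ncard : ℝ) ∂percolation G p := by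
  have := Fintype.ofFinite V
  have hsub : linearComponentEvent G α ⊆
      {S | α * Nat.card V ≤ ({v | S ∈ pathEvent G v k}.ncard : ℝ)} := by
    rintro S ⟨c, hc⟩
    refine hc.trans ?_
    have hsub : c.supp ⊆ {v | S ∈ pathEvent G v k} := by
      intro v hv
      have hncard : (graphBall G v k).ncard < c.supp.ncard := by
        have h1 := encard_graphBall_le hd v k
        rw [← (Set.toFinite _).cast_ncard_eq] at h1
        have h2 : (graphBall G v k).ncard ≤ (d + 1) ^ k := by exact_mod_cast h1
        have h3 : (((d + 1) ^ k : ℕ) : ℝ) < c.supp.ncard := by push_cast; linarith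
        exact h2.trans_lt (by exact_mod_cast h3)
      obtain ⟨w, hw, hw'⟩ := Set.exists_mem_notMem_of_ncard_lt_ncard hncard
      refine hasPathFrom_of_notMem_graphBall (openGraph_le G S) ?_ hw'
      exact SimpleGraph.ConnectedComponent.exact (hv.trans hw.symm)
    exact_mod_cast Set.ncard_le_ncard hsub
  have hint : Integrable (fun S ↦ ({v | S ∈ pathEvent G v k}.ncard : ℝ)) (percolation G p) := by
    simp_rw [ncard_pathEvent_eq_sum]
    exact integrable_finsetSum _ fun v _ ↦
      (memLp_indicator_pathEvent G v k p).integrable (by norm_num)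
  refine le_trans ?_ (mul_meas_ge_le_integral_of_nonneg (ae_of_all _ fun S ↦ by positivity) hint
    (α * Nat.card V))
  gcongr
  · exact le_trans (by positivity) hn.le
  · exact measure_ne_top _ _

end Concentration

/-! ### Path probabilities in the infinite graph -/

section Limit

variable {W : Type*}

theorem natCard_graphBall_ge {G : SimpleGraph W} [Infinite W] (hG : G.Connected) {d : ℕ}
    (hd : DegreeBoundedBy G d) (ρ : W) (k : ℕ) : k + 1 ≤ Nat.card (graphBall G ρ k) := by
  have hinf : {w | G.Reachable ρ w}.Infinite := by
    have : {w | G.Reachable ρ w} = Set.univ := Set.eq_univ_of_forall fun w ↦ hG ρ w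
    rw [this]
    exact Set.infinite_univ
  have h1 := ((hasPathFrom_induce_graphBall le_rfl ρ k).2
    (hasPathFrom_of_infinite hd le_rfl hinf k)).le_encard
  have := (Set.finite_of_encard_le_coe (encard_graphBall_le hd ρ k)).to_subtype
  rw [← (Set.toFinite _).cast_ncard_eq] at h1
  exact (by exact_mod_cast h1 : k + 1 ≤ _).trans (Set.ncard_le_card _)

theorem tendsto_natCard_atTop {G : SimpleGraph W} [Infinite W] (hG : G.Connected) {D : ℕ}
    (hD : DegreeBoundedBy G D) {ρ : W} {V : ℕ → Type*} [∀ n, Finite (V n)] [∀ n, Nonempty (V n)]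
    {Gn : ∀ n, SimpleGraph (V n)} (hconv : WeaklyConverges Gn G ρ) :
    Tendsto (fun n ↦ Nat.card (V n)) atTop atTop := by
  refine tendsto_atTop.2 fun R ↦ ?_
  -- A proportion below 1 leaves a vertex whose ball is a copy of one in `G`, and the latter is
  -- large because `G` is infinite and connected.
  filter_upwards [(hconv (R + 1) (by omega)).eventually_lt_const zero_lt_one] with n hn
  have hV : (0 : ℝ) < Nat.card (V n) := by exact_mod_cast Nat.card_pos
  rw [probBallsNotIso, div_lt_one hV] at hn
  have hn' : {v : V n | ¬ BallsIso (Gn n) v G ρ (R + 1)}.ncard < (Set.univ : Set (V n)).ncard := by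
    rw [Set.ncard_univ]; exact_mod_cast hn
  obtain ⟨v, -, hv⟩ := Set.exists_mem_notMem_of_ncard_lt_ncard hn'
  obtain ⟨φ, -⟩ := not_not.1 hv
  have h1 := natCard_graphBall_ge hG hD ρ (R + 1)
  rw [← Nat.card_congr φ.toEquiv] at h1
  have := Finite.card_subtype_le (fun w ↦ w ∈ graphBall (Gn n) v (R + 1))
  exact (by omega : R ≤ R + 1 + 1).trans (h1.trans this)

theorem tendsto_percolation_pathEvent {G : SimpleGraph W} {d : ℕ} (hd : DegreeBoundedBy G d)
    (ρ : W) {p : I} (h : percolation G p (infiniteComponentEvent G) = 0) :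
    Tendsto (fun k ↦ (percolation G p).real (pathEvent G ρ k)) atTop (𝓝 0) := by
  have hsub : ⋂ k, pathEvent G ρ k ⊆ infiniteComponentEvent G := by
    intro S hS
    refine ⟨(openGraph G S).connectedComponentMk ρ, ?_⟩
    have := infinite_of_hasPathFrom (fun k ↦ Set.mem_iInter.1 hS k)
    refine this.mono fun w hw ↦ ?_
    exact SimpleGraph.ConnectedComponent.sound (SimpleGraph.Reachable.symm hw)
  have h1 := tendsto_measure_iInter_atTop (μ := percolation G p) (s := fun k ↦ pathEvent G ρ k)
    (fun k ↦ (measurableSet_pathEvent (Set.finite_of_encard_le_coe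
      (encard_graphBall_le hd ρ k))).nullMeasurableSet)
    (fun k l hkl S hS ↦ HasPathFrom.of_le hS hkl) ⟨0, measure_ne_top _ _⟩
  rw [measure_mono_null hsub h] at h1
  exact (ENNReal.tendsto_toReal ENNReal.zero_ne_top).comp h1

/-- Some vertex `v` lies in an infinite component with positive probability. Opening a fixed path
from `ρ` to `v` by sprinkling moves this to `ρ`; raising `p` to `q` takes the place of a correlation
inequality. -/
theorem exists_le_percolation_pathEvent {G : SimpleGraph W} (hG : G.Connected) {d : ℕ}
    (hd : DegreeBoundedBy G d) (ρ : W) {p q : I} (hpq : p < q)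
    (h : percolation G p (infiniteComponentEvent G) ≠ 0) :
    ∃ θ : ℝ, 0 < θ ∧ ∀ k, θ ≤ (percolation G q).real (pathEvent G ρ k) := by
  classical
  have := hG.countable hd
  have hfin : ∀ v k, (graphBall G v k).Finite := fun v k ↦
    Set.finite_of_encard_le_coe (encard_graphBall_le hd v k)
  have hsub : infiniteComponentEvent G ⊆ ⋃ v, ⋂ k, pathEvent G v k := by
    rintro S ⟨c, hc⟩
    obtain ⟨v, rfl⟩ := c.exists_rep
    refine Set.mem_iUnion.2 ⟨v, Set.mem_iInter.2 fun k ↦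
      hasPathFrom_of_infinite hd (openGraph_le G S) (hc.mono fun w hw ↦ ?_) k⟩
    exact (SimpleGraph.ConnectedComponent.exact hw).symm
  obtain ⟨v, hv⟩ : ∃ v, percolation G p (⋂ k, pathEvent G v k) ≠ 0 := by
    by_contra! hcon
    exact h (measure_mono_null hsub (measure_iUnion_null hcon))
  obtain ⟨ε, hε, hsprinkle⟩ := exists_sprinkling hpq
  obtain ⟨γ⟩ := hG ρ v
  set F := γ.edges.toFinset
  have hmeas : MeasurableSet (⋂ k, pathEvent G v k) :=
    MeasurableSet.iInter fun k ↦ measurableSet_pathEvent (hfin v k)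
  refine ⟨((percolation G p) (⋂ k, pathEvent G v k) * (toNNReal ε : ℝ≥0∞) ^ F.card).toReal,
    ENNReal.toReal_pos (mul_ne_zero hv (pow_ne_zero _ ?_)) (ENNReal.mul_ne_top (measure_ne_top _ _)
      (by simp)), fun k ↦ ?_⟩
  · have : toNNReal ε ≠ 0 := fun h0 ↦ hε.ne' (by
      ext; simpa using congrArg NNReal.toReal h0)
    exact_mod_cast this
  · refine ENNReal.toReal_mono (measure_ne_top _ _) ?_
    rw [← setBernoulli_superset G.edgeSet ε F fun e he ↦
      γ.edges_subset_edgeSet (by simpa [F] using he)]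
    rw [percolation, percolation, ← hsprinkle G.edgeSet,
      Measure.map_apply measurable_set_union (measurableSet_pathEvent (hfin ρ k)),
      ← Measure.prod_prod]
    refine measure_mono ?_
    rintro ⟨S, T⟩ ⟨hS, hT⟩
    refine hasPathFrom_of_infinite hd (openGraph_le G _) ?_ k
    refine (infinite_of_hasPathFrom fun k ↦ Set.mem_iInter.1 hS k).mono fun w hw ↦ ?_
    refine SimpleGraph.Reachable.trans (v := v) ?_
      (hw.mono (openGraph_mono G Set.subset_union_left))
    refine ⟨γ.transfer _ fun e he ↦ ?_⟩
    have h2 : e ∈ T := hT (by simpa [F] using he)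
    have h3 := γ.edges_subset_edgeSet he
    induction e with
    | _ a b => exact openGraph_adj.2 ⟨Or.inr h2, h3⟩

end Limit

/-! ### Two-round exposure -/

section Sprinkling

theorem percolation_compl_linearComponentEvent_le {V : Type*} [Finite V] {G : SimpleGraph V}
    {p q ε : I} (hsprinkle : ((percolation G p).prod (percolation G ε)).map (fun z ↦ z.1 ∪ z.2) =
      percolation G q) {α : ℝ} {k : ℕ} {c : ℝ≥0∞}
    (hc : ∀ S : Set (Sym2 V), 3 * (α * Nat.card V) ≤ {v | S ∈ pathEvent G v k}.ncard →
      percolation G ε {T | ∀ c : (openGraph G (S ∪ T)).ConnectedComponent,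
        (c.supp.ncard : ℝ) < α * Nat.card V} ≤ c) :
    percolation G q (linearComponentEvent G α)ᶜ ≤
      percolation G p {S | ({v | S ∈ pathEvent G v k}.ncard : ℝ) < 3 * (α * Nat.card V)} + c := by
  classical
  set B := {S : Set (Sym2 V) | ({v | S ∈ pathEvent G v k}.ncard : ℝ) < 3 * (α * Nat.card V)}
  rw [← hsprinkle, Measure.map_apply measurable_set_union (measurableSet_of_finite _),
    Measure.prod_apply (measurable_set_union (measurableSet_of_finite _))]
  calc _ ≤ ∫⁻ S, (B.indicator 1 S + c) ∂percolation G p := by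
        refine lintegral_mono fun S ↦ ?_
        by_cases hS : S ∈ B
        · rw [Set.indicator_of_mem hS]
          exact prob_le_one.trans le_self_add
        · refine le_trans (le_of_eq ?_) ((hc S (not_lt.1 hS)).trans le_add_self)
          congr 1
          ext T
          simp [linearComponentEvent]
    _ = _ := by
        rw [lintegral_add_right _ measurable_const,
          lintegral_indicator_one (measurableSet_of_finite _)]
        simp

end Sprinkling

/-! ### The two phases -/

section Phases

variable {W : Type*} {G : SimpleGraph W} {ρ : W} {V : ℕ → Type*} [∀ n, Finite (V n)]
  [∀ n, Nonempty (V n)] {Gn : ∀ n, SimpleGraph (V n)} {d D : ℕ}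

theorem tendsto_percolation_linearComponentEvent_zero [Infinite W] (hG : G.Connected)
    (hD : DegreeBoundedBy G D) (hd : ∀ n, DegreeBoundedBy (Gn n) d)
    (hconv : WeaklyConverges Gn G ρ) {p : I}
    (hp : percolation G p (infiniteComponentEvent G) = 0) {α : ℝ} (hα : 0 < α) :
    Tendsto (fun n ↦ percolation (Gn n) p (linearComponentEvent (Gn n) α)) atTop (𝓝 0) := by
  have hcard := tendsto_natCard_atTop hG hD hconv
  rw [← ENNReal.tendsto_toReal_iff (fun n ↦ measure_ne_top _ _) ENNReal.zero_ne_top,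
    ENNReal.toReal_zero]
  rw [Metric.tendsto_nhds]
  intro η hη
  have hq := (tendsto_percolation_pathEvent hD ρ hp).eventually_lt_const
    (show 0 < α * η / 2 by positivity)
  -- Weak convergence speaks only of positive radii. The limiting path probability and the
  -- proportion of bad balls each use half of the budget αη in Markov's inequality.
  obtain ⟨k, hk, hk0⟩ := (hq.and (eventually_ge_atTop 1)).exists
  have hlarge : ∀ᶠ n in atTop, ((d + 1) ^ k : ℝ) < α * Nat.card (V n) :=
    ((tendsto_natCast_atTop_atTop.comp hcard).const_mul_atTop hα).eventually_gt_atTop _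
  filter_upwards [hlarge, (hconv k hk0).eventually_lt_const (show 0 < α * η / 2 by positivity)]
    with n hn hb
  have hN : (0 : ℝ) < Nat.card (V n) := by exact_mod_cast Nat.card_pos
  have h1 := mul_percolation_linearComponentEvent_le (hd n) k p hn
  have h2 := (abs_le.1 (abs_integral_ncard_pathEvent_sub_le (Gn n) G
    (Set.finite_of_encard_le_coe (encard_graphBall_le hD ρ k)) p)).2
  have h3 : α * Nat.card (V n) * (percolation (Gn n) p).real (linearComponentEvent (Gn n) α) <
      α * Nat.card (V n) * η := by
    have h4 : (Nat.card (V n) : ℝ) * probBallsNotIso (Gn n) G ρ k <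
      Nat.card (V n) * (α * η / 2) := by gcongr
    have h5 : (Nat.card (V n) : ℝ) * (percolation G p).real (pathEvent G ρ k) <
      Nat.card (V n) * (α * η / 2) := by gcongr
    nlinarith
  rw [Real.dist_eq, sub_zero, abs_of_nonneg ENNReal.toReal_nonneg]
  exact lt_of_mul_lt_mul_left h3 (by positivity)

/-- The path length is fixed by `h`, `α` and `d` before `k` is chosen. With k + 1 = Mj and m =
j⌊N/(Mj)⌋, the bound is a power of 2x^j, and x^j < 1/4 makes this base at most 1/2. Taking M >
4l/(hα) keeps the edges of all `m` paths within the budget. -/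
theorem exists_sprinkling_parameters {h α : ℝ} (hh : 0 < h) (hα : 0 < α) (d : ℕ) {ε : I}
    (hε : 0 < ε) : ∃ l k : ℕ, 0 < k ∧ ∀ N : ℕ, 0 < N → d * N < l * (h * (α * N)) ∧
      ∃ m : ℕ, 2 * (m * (2 * l)) ≤ h * (α * N) ∧
        2 ^ (N / (k + 1)) * (1 - (toNNReal ε : ℝ≥0∞) ^ (2 * l)) ^ m ≤
          (2⁻¹ : ℝ≥0∞) ^ (N / (k + 1)) := by
  obtain ⟨l, hl⟩ := exists_nat_gt (d / (h * α))
  rw [div_lt_iff₀ (by positivity)] at hl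
  have hl0 : 0 < l := by
    rcases Nat.eq_zero_or_pos l with rfl | hl0
    · simp only [Nat.cast_zero, zero_mul] at hl
      exact absurd hl (not_lt.2 (by positivity))
    · exact hl0
  set x : ℝ≥0∞ := 1 - (toNNReal ε : ℝ≥0∞) ^ (2 * l)
  have hx : x < 1 := by
    refine ENNReal.sub_lt_self ENNReal.one_ne_top one_ne_zero (pow_ne_zero _ ?_)
    have : toNNReal ε ≠ 0 := fun h0 ↦ hε.ne' (by
      ext; simpa using congrArg NNReal.toReal h0)
    exact_mod_cast this
  obtain ⟨j, hj, hj0⟩ := (((ENNReal.tendsto_pow_atTop_nhds_zero_of_lt_one hx).eventually_lt_const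
    (show (0 : ℝ≥0∞) < 2⁻¹ * 2⁻¹ by simp)).and (eventually_ge_atTop 1)).exists
  obtain ⟨M, hM, hM2⟩ := ((tendsto_natCast_atTop_atTop.eventually_gt_atTop
    (4 * l / (h * α))).and (eventually_ge_atTop 2)).exists
  rw [div_lt_iff₀ (by positivity)] at hM
  have hMj2 : 2 ≤ M * j := hM2.trans (Nat.le_mul_of_pos_right _ hj0)
  have hMj : M * j - 1 + 1 = M * j := by omega
  refine ⟨l, M * j - 1, by omega, fun N hN ↦ ⟨?_, j * (N / (M * j)), ?_, ?_⟩⟩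
  · have hN' : (0 : ℝ) < N := by exact_mod_cast hN
    have := mul_lt_mul_of_pos_right hl hN'
    linarith
  · have h1 : N / (M * j) * (M * j) ≤ N := Nat.div_mul_le_self _ _
    have h2 : ((N / (M * j) : ℕ) : ℝ) * (M * j) ≤ N := by exact_mod_cast h1
    have h3 := mul_le_mul_of_nonneg_left h2 (show 0 ≤ h * α by positivity)
    have h4 := mul_le_mul_of_nonneg_right hM.le
      (show (0 : ℝ) ≤ j * (N / (M * j) : ℕ) by positivity)
    push_cast
    linarith
  · rw [hMj, pow_mul, ← mul_pow]
    refine pow_le_pow_left' ?_ _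
    calc 2 * x ^ j ≤ 2 * (2⁻¹ * 2⁻¹) := by gcongr
      _ = 2⁻¹ := by rw [← mul_assoc, ENNReal.mul_inv_cancel (by simp) (by simp), one_mul]

theorem exists_tendsto_percolation_linearComponentEvent_one [Infinite W] (hG : G.Connected)
    (hD : DegreeBoundedBy G D) {h : ℝ} (hh : 0 < h)
    (hcheeger : ∀ n, ENNReal.ofReal h ≤ cheegerConst (Gn n))
    (hd : ∀ n, DegreeBoundedBy (Gn n) d) (hconv : WeaklyConverges Gn G ρ) {p q : I} (hpq : p < q)
    (hp : percolation G p (infiniteComponentEvent G) ≠ 0) :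
    ∃ α : ℝ, 0 < α ∧
      Tendsto (fun n ↦ percolation (Gn n) q (linearComponentEvent (Gn n) α)) atTop (𝓝 1) := by
  have hcard := tendsto_natCard_atTop hG hD hconv
  -- Two sprinklings: from `p` to `r` to reach the root in `G`, from `r` to `q` to merge components
  -- in `Gn n`.
  obtain ⟨r, hpr, hrq⟩ := exists_between hpq
  obtain ⟨θ, hθ, hθk⟩ := exists_le_percolation_pathEvent hG hD ρ hpr hp
  obtain ⟨ε, hε, hsprinkle⟩ := exists_sprinkling hrq
  -- Bad balls and the Chebyshev deviation each cost θ/4 of the density θ; the remaining θ/2 is the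
  -- 3α needed to cut into two parts of density α.
  have hα : 0 < θ / 6 := by positivity
  refine ⟨θ / 6, hα, ?_⟩
  obtain ⟨l, k, hk, hlk⟩ := exists_sprinkling_parameters hh hα d hε
  have hbound : ∀ᶠ n in atTop, percolation (Gn n) q (linearComponentEvent (Gn n) (θ / 6))ᶜ ≤
      ENNReal.ofReal ((d + 1) ^ (2 * k) / (θ / 4) ^ 2 / Nat.card (V n)) +
        2⁻¹ ^ (Nat.card (V n) / (k + 1)) := by
    filter_upwards [(hconv k hk).eventually_lt_const
      (show 0 < θ / 4 by positivity)] with n hb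
    have hN : 0 < Nat.card (V n) := Nat.card_pos
    have hN' : (0 : ℝ) < Nat.card (V n) := by exact_mod_cast hN
    obtain ⟨hl, m, hm, hle⟩ := hlk _ hN
    refine (percolation_compl_linearComponentEvent_le (hsprinkle (Gn n).edgeSet) (k := k)
      fun S hS ↦ (percolation_small_components_le hh (by positivity) (hcheeger n) (hd n) hl hm ε
        hS).trans hle).trans ?_
    gcongr
    refine (percolation_ncard_pathEvent_lt_le (hd n) k r (t := θ / 4 * Nat.card (V n))
      (by positivity) ?_).trans (ENNReal.ofReal_le_ofReal (le_of_eq ?_))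
    · have h1 := (abs_le.1 (abs_integral_ncard_pathEvent_sub_le (Gn n) G
        (Set.finite_of_encard_le_coe (encard_graphBall_le hD ρ k)) r)).1
      have h2 := mul_le_mul_of_nonneg_left (hθk k) hN'.le
      have h3 := mul_le_mul_of_nonneg_left hb.le hN'.le
      linarith
    · field_simp
  have hzero : Tendsto (fun n ↦ ENNReal.ofReal ((d + 1) ^ (2 * k) / (θ / 4) ^ 2 /
      Nat.card (V n)) + 2⁻¹ ^ (Nat.card (V n) / (k + 1))) atTop (𝓝 0) := by
    have h1 : Tendsto (fun n ↦ ENNReal.ofReal ((d + 1) ^ (2 * k) / (θ / 4) ^ 2 /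
        Nat.card (V n))) atTop (𝓝 0) := by
      simpa using ENNReal.tendsto_ofReal
        (tendsto_const_nhds.div_atTop (tendsto_natCast_atTop_atTop.comp hcard))
    have h2 := (ENNReal.tendsto_pow_atTop_nhds_zero_of_lt_one
      (ENNReal.inv_lt_one.2 ENNReal.one_lt_two)).comp
      ((Nat.tendsto_div_const_atTop (Nat.succ_ne_zero k)).comp hcard)
    simpa using h1.add h2
  have hcompl : Tendsto (fun n ↦ percolation (Gn n) q (linearComponentEvent (Gn n) (θ / 6))ᶜ)
      atTop (𝓝 0) :=
    tendsto_of_tendsto_of_tendsto_of_le_of_le' tendsto_const_nhds hzero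
      (Eventually.of_forall fun _ ↦ zero_le) hbound
  have hsub := ENNReal.Tendsto.sub (tendsto_const_nhds (x := (1 : ℝ≥0∞))) hcompl
    (Or.inl ENNReal.one_ne_top)
  rw [tsub_zero] at hsub
  refine hsub.congr fun n ↦ ?_
  rw [← prob_compl_eq_one_sub (measurableSet_of_finite _), compl_compl]

end Phases

theorem theorem1p2 {W : Type*} (G : SimpleGraph W) (ρ : W) (hGinf : Infinite W)
    (hGconn : G.Connected) (hGdeg : ∃ D : ℕ, DegreeBoundedBy G D)
    {V : ℕ → Type*} [∀ n, Finite (V n)] [∀ n, Nonempty (V n)] (Gn : ∀ n, SimpleGraph (V n))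
    (h : ℝ) (hh : 0 < h) (hcheeger : ∀ n, ENNReal.ofReal h ≤ cheegerConst (Gn n))
    (d : ℕ) (hdeg : ∀ n, DegreeBoundedBy (Gn n) d)
    (hconv : WeaklyConverges Gn G ρ) (p : I) :
    (p < criticalProb G → ∀ α : ℝ, 0 < α →
      Tendsto (fun n => percolation (Gn n) p (linearComponentEvent (Gn n) α)) atTop (𝓝 0)) ∧
    (criticalProb G < p → ∃ α : ℝ, 0 < α ∧
      Tendsto (fun n => percolation (Gn n) p (linearComponentEvent (Gn n) α)) atTop (𝓝 1)) := by
  obtain ⟨D, hD⟩ := hGdeg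
  constructor
  · intro hp α hα
    refine tendsto_percolation_linearComponentEvent_zero hGconn hD hdeg hconv ?_ hα
    by_contra hne
    exact (sInf_le (pos_iff_ne_zero.2 hne) : criticalProb G ≤ p).not_gt hp
  · intro hp
    -- The infimum is taken in `I`, where the empty set has infimum 1, so `hp` does provide a
    -- parameter `r`. Having r < p leaves the room needed for sprinkling.
    obtain ⟨r, hr, hrp⟩ := sInf_lt_iff.1 hp
    exact exists_tendsto_percolation_linearComponentEvent_one hGconn hD hh hcheeger hdeg hconv hrp
      (pos_iff_ne_zero.1 hr)
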